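/- Let $h_1,h_2,\dots$ be algebraically independent variables over $\mathbb R$, put $h_0=1$ and $h_n=0$ for $n<0$, and for a partition $\lambda=(\lambda_1\ge\dots\ge\lambda_m>0)$ let $s_\lambda=\det(h_{\lambda_i-i+j})_{1\le i,j\le m}$ be its Schur function. Let $N\ge 0$. Let $\mathcal{SP}_N$ be the set of finite multisets $A$ of nonempty partitions with at most two parts such that $\sum_{\lambda\in A}|\lambda|=N$. For $A\in\mathcal{SP}_N$ put $s_A=\prod_{\lambda\in A}s_\lambda$, and let $\phi(A)\vdash N$ be the partition whose parts are all the parts of all members of $A$ (with multiplicity). Let $\mathcal C_N^2=\{\sum_{A\in\mathcal{SP}_N}c_As_A\mid c_A\in\mathbb R,\ c_A\ge 0\}$. An element $A\in\mathcal{SP}_N$ is called extreme in $\mathcal C_N^2$ if $s_A$ is not a linear combination with non-negative real coefficients of the $s_B$ with $B\in\mathcal{SP}_N$, $B\ne A$. The multiset $A$ is called nested if no two of its members $\lambda,\mu$ (distinct occurrences in $A$, in either order) satisfy any of the following: 1. $\lambda=(\lambda_1\ge\lambda_2>0)$, $\mu=(\mu_1\ge\mu_2>0)$ and $\lambda_1>\mu_1\ge\lambda_2>\mu_2$;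 2. $\lambda=(\lambda_1>\lambda_2>0)$, $\mu=(\mu_1>0)$ and $\lambda_1\ge\mu_1\ge\lambda_2$; 3. $\lambda=(\lambda_1>0)$ and $\mu=(\mu_1>0)$. Let $\lambda\vdash N$. If there is exactly one nested $A\in\mathcal{SP}_N$ with $\phi(A)=\lambda$, then this $A$ is extreme in $\mathcal C_N^2$. -/

import Mathlib

namespace SchurCone

/-- A nonempty partition `(λ₁ ≥ λ₂ ≥ ⋯ ≥ λₘ > 0)` with `1 ≤ m ≤ k` parts: an element of `𝒫ᵏ`. -/
@[ext]
structure Shape (k : ℕ) where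
  /-- The parts, in weakly decreasing order. -/
  parts : List ℕ
  sorted : parts.Pairwise (· ≥ ·)
  pos : ∀ i ∈ parts, 0 < i
  ne_nil : parts ≠ []
  length_le : parts.length ≤ k

/-- The variables `h₁, h₂, …` (the generators of the polynomial ring over `ℝ`), with the usual
conventions `h₀ = 1` and `hₙ = 0` for `n < 0`. -/
noncomputable def h : ℤ → MvPolynomial ℕ+ ℝ
  | Int.ofNat 0 => 1
  | Int.ofNat (n + 1) => MvPolynomial.X n.succPNat
  | Int.negSucc _ => 0

variable {k : ℕ}

/-- The Schur function `s_λ = det (h_{λᵢ - i + j})`, as a polynomial in the `h`'s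
(Jacobi–Trudi). -/
noncomputable def schur (p : Shape k) : MvPolynomial ℕ+ ℝ :=
  (Matrix.of fun i j : Fin p.parts.length =>
    h ((p.parts.get i : ℤ) - ((i : ℕ) : ℤ) + ((j : ℕ) : ℤ))).det

/-- `w(A)`, the sum of the sizes of the members of `A`. -/
def weight (A : Multiset (Shape k)) : ℕ := (A.map fun p => p.parts.sum).sum

/-- `s_A`, the product of the Schur functions of the members of `A`. -/
noncomputable def schurProd (A : Multiset (Shape k)) : MvPolynomial ℕ+ ℝ := (A.map schur).prod

/-- `𝒮𝒫_N^k`, the multisets of partitions with at most `k` parts, of total size `N`. -/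
def SP (k N : ℕ) : Set (Multiset (Shape k)) := {A | weight A = N}

/-- The convex cone of all linear combinations, with non-negative real coefficients, of the
products `s_A`, `A ∈ S`. The `(N, k)`-Schur cone is `cone (SP k N)`. -/
noncomputable def cone (S : Set (Multiset (Shape k))) : PointedCone ℝ (MvPolynomial ℕ+ ℝ) :=
  PointedCone.hull ℝ (schurProd '' S)

/-- `A` is extreme in the `(N, k)`-Schur cone: `A` is one of the generators, and `s_A` is not a
linear combination with non-negative coefficients of the other generators. -/
def IsExtreme (k N : ℕ) (A : Multiset (Shape k)) : Prop :=
  A ∈ SP k N ∧ schurProd A ∉ cone (SP k N \ {A})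

/-- The three forbidden configurations for an ordered pair of partitions with at most two
parts. -/
def Forbidden (p q : Shape 2) : Prop :=
  (∃ a b c d, p.parts = [a, b] ∧ q.parts = [c, d] ∧ a > c ∧ c ≥ b ∧ b > d) ∨
  (∃ a b c, p.parts = [a, b] ∧ q.parts = [c] ∧ a > b ∧ a ≥ c ∧ c ≥ b) ∨
  (∃ a c, p.parts = [a] ∧ q.parts = [c])

/-- `A` is nested if no two members (counted with multiplicity) form a forbidden pair. -/
def Nested (A : Multiset (Shape 2)) : Prop :=
  ∀ p q : Shape 2, ({p, q} : Multiset (Shape 2)) ≤ A → ¬ Forbidden p q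

/-- The multiset of parts of the partition `φ(A)`: all parts of all members of `A`. -/
def phi (A : Multiset (Shape k)) : Multiset ℕ := (A.map fun p => (p.parts : Multiset ℕ)).sum

/-- `𝒮𝒮𝒫_λ`, the nested `A` with `φ(A) = λ`, for a partition `λ` of `N`. -/
def SSP {N : ℕ} (lam : N.Partition) : Set (Multiset (Shape 2)) :=
  {A | A ∈ SP 2 N ∧ Nested A ∧ phi A = lam.parts}

end SchurCone

/-!
The proof combines a straightening algorithm with a comparison of lowest-order terms.

*Straightening.* If two members of `A` form a forbidden pair, a three-term Plücker relation between
`2 × 2` minors of the matrix with rows `(hₙ, hₙ₊₁)` writes `s_A = s_B + s_C`, where `B` has the same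
parts as `A` and `C` has more spread out parts (`straighten_of_not_nested`). A potential decreases
from `A` to `B`, so the process ends at a nested multiset. If `A` is the only nested multiset with
`φ(A) = λ`, then every other `B` with `φ(B) = λ` satisfies `s_B = s_A + x`, where `x ≠ 0` is a
nonnegative combination of products `s_C` with more spread out parts (`exists_schurProd_eq_add`).

*Lowest-order terms.* For a strictly convex `f` with `f 0 = 0`, the specialization `hₙ ↦ X ^ f n`
sends `s_B` to `X ^ F(B)` plus higher terms, where `F(B)` is the sum of `f` over the parts of `B`
(`hasUnitLead_schurProd`), and spreading out the parts increases `F`. Hence a nonzero nonnegative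
combination of the `s_B` has a positive trailing coefficient, and in particular the cone is salient
(`eq_zero_or_posLeadAt_of_mem_cone`). For `f n = M ^ n - 1` with `M` large, `F` determines the
partition `φ(B)` of `N`, by uniqueness of base `M` digits (`phi_eq_of_degSum_eq`).

Suppose now that `s_A` is a nonnegative combination of other generators. The generators with
`F(B) < F(A)` cannot occur. Those with `F(B) = F(A)` have `φ(B) = λ`, so they contribute
`c • s_A + x` with `x` in the cone of generators with `F > F(A)`, and `x ≠ 0` unless `c = 0`. The
coefficient of `X ^ F(A)` gives `c = 1`, so `x ≠ 0` and the remaining generators sum to zero, against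
salience (`schurProd_notMem_cone`).
-/

open Polynomial

namespace SchurCone

/-! ### Schur functions of shapes with at most two parts -/

/-- The shape `(a)`. -/
def single (a : ℕ) (ha : 0 < a) : Shape 2 :=
  ⟨[a], by simp, by simpa using ha, by simp, by simp⟩

/-- The shape `(a, b)`. -/
def pair (a b : ℕ) (hab : b ≤ a) (hb : 0 < b) : Shape 2 :=
  ⟨[a, b], by simpa using hab, by simp; omega, by simp, by simp⟩

/-- The one-part shape `(n)` as a one-element multiset; the empty multiset for `n = 0`, in accordance
with `h₀ = 1`. -/
def singleOrEmpty (n : ℕ) : Multiset (Shape 2) :=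
  if hn : 0 < n then {single n hn} else 0

theorem Shape.eq_single_or_eq_pair (p : Shape 2) :
    (∃ a ha, p = single a ha) ∨ ∃ a b hab hb, p = pair a b hab hb := by
  obtain ⟨l, h1, h2, h3, h4⟩ := p
  match l, h1, h2, h3, h4 with
  | [], _, _, h3, _ => exact absurd rfl h3
  | [a], _, h2, _, _ => exact Or.inl ⟨a, h2 a (by simp), rfl⟩
  | [a, b], h1, h2, _, _ =>
    exact Or.inr ⟨a, b, by simpa using h1, h2 b (by simp), rfl⟩
  | _ :: _ :: _ :: _, _, _, _, h4 => simp at h4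

theorem Shape.eq_single {p : Shape 2} {a : ℕ} (hp : p.parts = [a]) :
    ∃ ha, p = single a ha :=
  ⟨p.pos a (by simp [hp]), Shape.ext hp⟩

theorem Shape.eq_pair {p : Shape 2} {a b : ℕ} (hp : p.parts = [a, b]) :
    ∃ hab hb, p = pair a b hab hb :=
  ⟨by simpa [hp] using p.sorted, p.pos b (by simp [hp]), Shape.ext hp⟩

theorem schur_single (a : ℕ) (ha : 0 < a) : schur (single a ha) = h (a : ℤ) := by
  refine (Matrix.det_fin_one _).trans ?_
  change h ((a : ℤ) - (0 : ℕ) + (0 : ℕ)) = _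
  simp

theorem schur_pair (a b : ℕ) (hab : b + 1 ≤ a) (hb : 0 < b + 1) :
    schur (pair a (b + 1) hab hb) =
      h (a : ℤ) * h ((b + 1 : ℕ) : ℤ) - h ((a + 1 : ℕ) : ℤ) * h (b : ℤ) := by
  refine (Matrix.det_fin_two _).trans ?_
  change h ((a : ℤ) - (0 : ℕ) + (0 : ℕ)) * h (((b + 1 : ℕ) : ℤ) - (1 : ℕ) + (1 : ℕ)) -
    h ((a : ℤ) - (0 : ℕ) + (1 : ℕ)) * h (((b + 1 : ℕ) : ℤ) - (1 : ℕ) + (0 : ℕ)) = _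
  simp

@[simp] theorem schurProd_zero : schurProd (0 : Multiset (Shape k)) = 1 := by simp [schurProd]

@[simp] theorem schurProd_singleton (p : Shape k) : schurProd {p} = schur p := by simp [schurProd]

@[simp] theorem schurProd_add (A B : Multiset (Shape k)) :
    schurProd (A + B) = schurProd A * schurProd B := by simp [schurProd]

@[simp] theorem phi_zero : phi (0 : Multiset (Shape k)) = 0 := by simp [phi]

theorem phi_singleton (p : Shape k) : phi {p} = p.parts := by simp [phi]

@[simp] theorem phi_add (A B : Multiset (Shape k)) : phi (A + B) = phi A + phi B := by
  simp [phi]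

@[simp] theorem phi_single (a : ℕ) (ha : 0 < a) : phi {single a ha} = {a} := by
  rw [phi_singleton]
  rfl

@[simp] theorem phi_pair (a b : ℕ) (hab : b ≤ a) (hb : 0 < b) :
    phi {pair a b hab hb} = {a} + {b} := by
  rw [phi_singleton]
  rfl

theorem schurProd_singleOrEmpty (n : ℕ) : schurProd (singleOrEmpty n) = h (n : ℤ) := by
  unfold singleOrEmpty
  split
  · simp [schur_single]
  · obtain rfl : n = 0 := by omega
    simp [h]

theorem sum_phi (A : Multiset (Shape k)) : (phi A).sum = weight A := by
  induction A using Multiset.induction_on with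
  | empty => simp [phi, weight]
  | cons p A ih => simp_all [phi, weight]

theorem pos_of_mem_phi {A : Multiset (Shape k)} {n : ℕ} (hn : n ∈ phi A) : 0 < n := by
  induction A using Multiset.induction_on with
  | empty => simp at hn
  | cons p A ih =>
    rw [← Multiset.singleton_add, phi_add, phi_singleton, Multiset.mem_add] at hn
    exact hn.elim (p.pos n) ih

/-! ### The degree of a multiset of shapes and the specialization to one variable -/

/-- The sum of `f` over all parts of all members of `A`. -/
def degSum (f : ℕ → ℕ) (A : Multiset (Shape k)) : ℕ := ((phi A).map f).sum

@[simp] theorem degSum_zero (f : ℕ → ℕ) : degSum f (0 : Multiset (Shape k)) = 0 := by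
  simp [degSum]

@[simp] theorem degSum_add (f : ℕ → ℕ) (A B : Multiset (Shape k)) :
    degSum f (A + B) = degSum f A + degSum f B := by simp [degSum]

@[simp] theorem degSum_single (f : ℕ → ℕ) (a : ℕ) (ha : 0 < a) :
    degSum f {single a ha} = f a := by simp [degSum]

@[simp] theorem degSum_pair (f : ℕ → ℕ) (a b : ℕ) (hab : b ≤ a) (hb : 0 < b) :
    degSum f {pair a b hab hb} = f a + f b := by simp [degSum]

/-- Exponents for which the specialization `hₙ ↦ X ^ f n` respects `h₀ = 1`, and for which the
image of `h_a h_(b+1)` has lower degree than that of `h_(a+1) h_b`, so that it is the lowest term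
of the image of `s_(a, b+1)`. -/
structure StrictlyConvex (f : ℕ → ℕ) : Prop where
  map_zero : f 0 = 0
  lt : ∀ a b, b < a → f a + f (b + 1) < f (a + 1) + f b

theorem degSum_singleOrEmpty {f : ℕ → ℕ} (hf : f 0 = 0) (n : ℕ) :
    degSum f (singleOrEmpty n) = f n := by
  unfold singleOrEmpty
  split
  · simp
  · obtain rfl : n = 0 := by omega
    simp [hf]

/-- The specialization `hₙ ↦ X ^ f n`. -/
noncomputable def specialize (f : ℕ → ℕ) : MvPolynomial ℕ+ ℝ →ₐ[ℝ] ℝ[X] :=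
  MvPolynomial.aeval fun n => X ^ f n

theorem specialize_h {f : ℕ → ℕ} (hf : f 0 = 0) (n : ℕ) :
    specialize f (h (n : ℤ)) = X ^ f n := by
  cases n with
  | zero => simp [h, hf]
  | succ n =>
    change specialize f (MvPolynomial.X n.succPNat) = _
    simp [specialize]

/-- `p = X ^ d + (terms of degree greater than d)`. -/
def HasUnitLead (d : ℕ) (p : ℝ[X]) : Prop := ∃ u : ℝ[X], u.coeff 0 = 1 ∧ p = X ^ d * u

theorem HasUnitLead.mul {d e : ℕ} {p q : ℝ[X]} (hp : HasUnitLead d p) (hq : HasUnitLead e q) :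
    HasUnitLead (d + e) (p * q) := by
  obtain ⟨u, hu, rfl⟩ := hp
  obtain ⟨v, hv, rfl⟩ := hq
  exact ⟨u * v, by simp [mul_coeff_zero, hu, hv], by ring⟩

theorem HasUnitLead.coeff_of_lt {d i : ℕ} {p : ℝ[X]} (hp : HasUnitLead d p) (hi : i < d) :
    p.coeff i = 0 := by
  obtain ⟨u, -, rfl⟩ := hp
  rw [coeff_X_pow_mul', if_neg (by omega)]

theorem HasUnitLead.coeff_self {d : ℕ} {p : ℝ[X]} (hp : HasUnitLead d p) : p.coeff d = 1 := by
  obtain ⟨u, hu, rfl⟩ := hp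
  rw [coeff_X_pow_mul', if_pos le_rfl, Nat.sub_self, hu]

theorem hasUnitLead_schur {f : ℕ → ℕ} (hf : StrictlyConvex f) (p : Shape 2) :
    HasUnitLead (degSum f {p}) (specialize f (schur p)) := by
  obtain ⟨a, ha, rfl⟩ | ⟨a, b, hab, hb, rfl⟩ := p.eq_single_or_eq_pair
  · exact ⟨1, by simp, by simp [schur_single, specialize_h hf.map_zero]⟩
  · obtain ⟨b, rfl⟩ := Nat.exists_eq_add_one.2 hb
    obtain ⟨e, he⟩ := Nat.exists_eq_add_of_lt (hf.lt a b hab)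
    refine ⟨1 - X ^ (e + 1), by simp, ?_⟩
    rw [schur_pair, map_sub, map_mul, map_mul]
    simp only [specialize_h hf.map_zero, degSum_pair, ← pow_add, he]
    ring

theorem hasUnitLead_schurProd {f : ℕ → ℕ} (hf : StrictlyConvex f) (A : Multiset (Shape 2)) :
    HasUnitLead (degSum f A) (specialize f (schurProd A)) := by
  induction A using Multiset.induction_on with
  | empty => exact ⟨1, by simp, by simp⟩
  | cons p A ih =>
    rw [← Multiset.singleton_add, degSum_add, schurProd_add, map_mul, schurProd_singleton]
    exact (hasUnitLead_schur hf p).mul ih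

/-! ### Polynomials with positive trailing coefficient -/

/-- The nonzero coefficient of lowest degree of `p` is in degree `d`, and it is positive. -/
def PosLeadAt (d : ℕ) (p : ℝ[X]) : Prop := (∀ i < d, p.coeff i = 0) ∧ 0 < p.coeff d

theorem HasUnitLead.posLeadAt {d : ℕ} {p : ℝ[X]} (hp : HasUnitLead d p) : PosLeadAt d p :=
  ⟨fun _ hi => hp.coeff_of_lt hi, by simp [hp.coeff_self]⟩

theorem PosLeadAt.ne_zero {d : ℕ} {p : ℝ[X]} (hp : PosLeadAt d p) : p ≠ 0 := by
  rintro rfl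
  simpa using hp.2

theorem PosLeadAt.smul {d : ℕ} {p : ℝ[X]} (hp : PosLeadAt d p) {c : ℝ} (hc : 0 < c) :
    PosLeadAt d (c • p) :=
  ⟨fun i hi => by simp [hp.1 i hi], by simpa using mul_pos hc hp.2⟩

theorem PosLeadAt.add {d e : ℕ} {p q : ℝ[X]} (hp : PosLeadAt d p) (hq : PosLeadAt e q) :
    PosLeadAt (min d e) (p + q) := by
  refine ⟨fun i hi => ?_, ?_⟩
  · rw [coeff_add, hp.1 i (by omega), hq.1 i (by omega), add_zero]
  · rw [coeff_add]
    rcases lt_trichotomy d e with hde | rfl | hde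
    · rw [min_eq_left hde.le, hq.1 d hde, add_zero]
      exact hp.2
    · rw [min_self]
      exact add_pos hp.2 hq.2
    · rw [min_eq_right hde.le, hp.1 e hde, zero_add]
      exact hq.2

/-- A nonzero element of a cone of products of Schur functions specializes to a polynomial with
positive trailing coefficient, in the degree of one of the generators. -/
theorem eq_zero_or_posLeadAt_of_mem_cone {f : ℕ → ℕ} (hf : StrictlyConvex f)
    {T : Set (Multiset (Shape 2))} {x : MvPolynomial ℕ+ ℝ} (hx : x ∈ cone T) :
    x = 0 ∨ ∃ B ∈ T, PosLeadAt (degSum f B) (specialize f x) := by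
  unfold cone at hx
  induction hx using Submodule.span_induction with
  | mem x hx =>
    obtain ⟨B, hB, rfl⟩ := hx
    exact Or.inr ⟨B, hB, (hasUnitLead_schurProd hf B).posLeadAt⟩
  | zero => exact Or.inl rfl
  | add x y _ _ hx hy =>
    obtain rfl | ⟨B, hB, hx⟩ := hx
    · simpa using hy
    obtain rfl | ⟨C, hC, hy⟩ := hy
    · exact Or.inr ⟨B, hB, by simpa using hx⟩
    · have hxy := hx.add hy
      rw [← map_add] at hxy
      rcases min_choice (degSum f B) (degSum f C) with hm | hm <;> rw [hm] at hxy
      · exact Or.inr ⟨B, hB, hxy⟩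
      · exact Or.inr ⟨C, hC, hxy⟩
  | smul c x _ hx =>
    obtain rfl | ⟨B, hB, hx⟩ := hx
    · simp
    · obtain hc | hc := eq_or_lt_of_le c.2
      · left
        change (c : ℝ) • x = 0
        rw [← hc, zero_smul]
      · refine Or.inr ⟨B, hB, ?_⟩
        change PosLeadAt _ (specialize f ((c : ℝ) • x))
        rw [map_smul]
        exact hx.smul hc

theorem coeff_eq_zero_of_mem_cone {f : ℕ → ℕ} (hf : StrictlyConvex f)
    {T : Set (Multiset (Shape 2))} {x : MvPolynomial ℕ+ ℝ} (hx : x ∈ cone T) {i : ℕ}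
    (hi : ∀ B ∈ T, i < degSum f B) : (specialize f x).coeff i = 0 := by
  obtain rfl | ⟨B, hB, hx⟩ := eq_zero_or_posLeadAt_of_mem_cone hf hx
  · simp
  · exact hx.1 i (hi B hB)

/-! ### Straightening -/

/-- A potential which every straightening step decreases, as long as all parts are less than
`K`. It encodes the lexicographic order on the number of one-part members, the sum of the
differences `a - b`, and the sum of the products `a * b`, over all two-part members `(a, b)`. -/
def potential (K : ℕ) (A : Multiset (Shape 2)) : ℕ :=
  (A.map fun p => match p.parts with
    | [a, b] => K * (a - b) + a * b
    | _ => K * K).sum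

@[simp] theorem potential_add (K : ℕ) (A B : Multiset (Shape 2)) :
    potential K (A + B) = potential K A + potential K B := by simp [potential]

@[simp] theorem potential_single (K a : ℕ) (ha : 0 < a) : potential K {single a ha} = K * K := by
  simp [potential, single]

@[simp] theorem potential_pair (K a b : ℕ) (hab : b ≤ a) (hb : 0 < b) :
    potential K {pair a b hab hb} = K * (a - b) + a * b := by simp [potential, pair]

/-- One straightening step for a forbidden pair `p`, `q`. In each case the relation is
`[i, k] [j, l] = [i, l] [j, k] + [i, j] [k, l]` for the minors `[i, j] = hᵢ hⱼ₊₁ - hᵢ₊₁ hⱼ`, with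
`s_(a, b) = [a, b - 1]`, `s_(a) = [a, -1]`, or `s_(a) = [∞, a - 1]` where the index `∞` stands for
the row `(1, 0)`. -/
theorem straighten_forbidden {f : ℕ → ℕ} (hf : StrictlyConvex f) {p q : Shape 2}
    (hpq : Forbidden p q) {K : ℕ} (hK : ∀ n ∈ phi ({p} + {q}), n < K) :
    ∃ B C : Multiset (Shape 2), schur p * schur q = schurProd B + schurProd C ∧
      phi B = phi ({p} + {q}) ∧ degSum f ({p} + {q}) < degSum f C ∧
      potential K B < potential K ({p} + {q}) := by
  obtain ⟨a, b, c, d, hp, hq, hac, hcb, hbd⟩ | ⟨a, b, c, hp, hq, hab, hac, hcb⟩ | ⟨a, c, hp, hq⟩ :=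
    hpq
  · obtain ⟨hba, hb, rfl⟩ := Shape.eq_pair hp
    obtain ⟨hdc, hd, rfl⟩ := Shape.eq_pair hq
    obtain ⟨b, rfl⟩ := Nat.exists_eq_add_one.2 hb
    obtain ⟨d, rfl⟩ := Nat.exists_eq_add_one.2 hd
    refine ⟨{pair a (d + 1) (by omega) hd} + {pair c (b + 1) hcb hb},
      {pair a (c + 1) hac (by omega)} + {pair b (d + 1) (by omega) hd}, ?_, ?_, ?_, ?_⟩
    · simp only [schurProd_add, schurProd_singleton, schur_pair]
      ring
    · simp only [phi_add, phi_pair]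
      abel
    · have := hf.lt c b hcb
      simp only [degSum_add, degSum_pair]
      omega
    · simp only [potential_add, potential_pair]
      zify [hba, hdc, hcb, (by omega : d + 1 ≤ a)]
      zify at hac hbd
      nlinarith
  · obtain ⟨hba, hb, rfl⟩ := Shape.eq_pair hp
    obtain ⟨hc, rfl⟩ := Shape.eq_single hq
    obtain ⟨b, rfl⟩ := Nat.exists_eq_add_one.2 hb
    -- For `c < a`, write `s_(c) = [c, -1]`; for `c = a` that relation is trivial, and
    -- `s_(c) = [∞, c - 1]` is used instead.
    obtain hca | rfl := lt_or_eq_of_le hac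
    · refine ⟨{single a (by omega)} + {pair c (b + 1) hcb hb},
        {pair a (c + 1) hca (by omega)} + singleOrEmpty b, ?_, ?_, ?_, ?_⟩
      · simp only [schurProd_add, schurProd_singleton, schur_pair, schur_single,
          schurProd_singleOrEmpty]
        ring
      · simp only [phi_add, phi_pair, phi_single]
        abel
      · have := hf.lt c b hcb
        simp only [degSum_add, degSum_pair, degSum_single, degSum_singleOrEmpty hf.map_zero]
        omega
      · simp only [potential_add, potential_pair, potential_single]
        zify [hba, hcb]
        zify at hca
        have : a < K := hK a (by simp [phi_add, -Multiset.singleton_add])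
        nlinarith
    · obtain ⟨c, rfl⟩ := Nat.exists_eq_add_one.2 hc
      refine ⟨{single (b + 1) hb} + {pair (c + 1) (c + 1) le_rfl hc},
        {single (c + 1 + 1) (by omega)} + {pair c (b + 1) (by omega) hb}, ?_, ?_, ?_, ?_⟩
      · simp only [schurProd_add, schurProd_singleton, schur_pair, schur_single]
        ring
      · simp only [phi_add, phi_pair, phi_single]
        abel
      · have := hf.lt (c + 1) c (by omega)
        simp only [degSum_add, degSum_pair, degSum_single]
        omega
      · simp only [potential_add, potential_pair, potential_single]
        have : c + 1 < K := hK (c + 1) (by simp [phi_add, -Multiset.singleton_add])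
        obtain ⟨e, rfl⟩ : ∃ e, c = b + 1 + e := Nat.exists_eq_add_of_le (by omega)
        rw [Nat.sub_self, (by omega : b + 1 + e + 1 - (b + 1) = e + 1)]
        nlinarith
  · obtain ⟨ha, rfl⟩ := Shape.eq_single hp
    obtain ⟨hc, rfl⟩ := Shape.eq_single hq
    wlog hca : c ≤ a generalizing a c
    · rw [add_comm {single a ha}] at hK ⊢
      rw [mul_comm]
      exact this c a hc rfl ha rfl hK (by omega)
    obtain ⟨c, rfl⟩ := Nat.exists_eq_add_one.2 hc
    refine ⟨{pair a (c + 1) hca hc}, {single (a + 1) (by omega)} + singleOrEmpty c,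
      ?_, ?_, ?_, ?_⟩
    · simp only [schurProd_add, schurProd_singleton, schur_pair, schur_single,
        schurProd_singleOrEmpty]
      ring
    · simp only [phi_add, phi_pair, phi_single]
    · have := hf.lt a c hca
      simp only [degSum_add, degSum_single, degSum_singleOrEmpty hf.map_zero]
      omega
    · have : a < K := hK a (by simp [phi_add, -Multiset.singleton_add])
      simp only [potential_add, potential_pair, potential_single]
      zify [hca]
      zify at hca this
      nlinarith

theorem straighten_of_not_nested {f : ℕ → ℕ} (hf : StrictlyConvex f) {A : Multiset (Shape 2)}
    (hA : ¬ Nested A) {K : ℕ} (hK : ∀ n ∈ phi A, n < K) :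
    ∃ B C : Multiset (Shape 2), schurProd A = schurProd B + schurProd C ∧
      phi B = phi A ∧ degSum f A < degSum f C ∧ potential K B < potential K A := by
  simp only [Nested, not_forall, not_not] at hA
  obtain ⟨p, q, hle, hpq⟩ := hA
  obtain ⟨R, rfl⟩ := Multiset.le_iff_exists_add.1 hle
  have hins : ({p, q} : Multiset (Shape 2)) = {p} + {q} := rfl
  rw [hins] at hK ⊢
  obtain ⟨B, C, h1, h2, h3, h4⟩ := straighten_forbidden hf hpq (K := K) fun n hn =>
    hK n (by rw [phi_add]; exact Multiset.mem_add.2 (Or.inl hn))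
  refine ⟨B + R, C + R, ?_, ?_, ?_, ?_⟩
  · simp only [schurProd_add, schurProd_singleton, h1, add_mul]
  · rw [phi_add, h2, ← phi_add]
  · simp only [degSum_add] at h3 ⊢
    omega
  · simp only [potential_add] at h4 ⊢
    omega

/-- If `A` is the only nested multiset with its parts, then straightening any other multiset with
these parts ends at `A`, and leaves a nonzero remainder. -/
theorem exists_schurProd_eq_add {f : ℕ → ℕ} (hf : StrictlyConvex f) {A : Multiset (Shape 2)}
    (huniq : ∀ B, Nested B → phi B = phi A → B = A) (B : Multiset (Shape 2))
    (hB : phi B = phi A) (hBA : B ≠ A) :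
    ∃ x ∈ cone {C : Multiset (Shape 2) | degSum f A < degSum f C}, x ≠ 0 ∧
      schurProd B = schurProd A + x := by
  induction hm : potential ((phi A).sum + 1) B using Nat.strong_induction_on generalizing B with
  | _ m ih =>
    subst hm
    obtain ⟨B', C, h1, h2, h3, h4⟩ := straighten_of_not_nested hf
      (fun hN => hBA (huniq B hN hB)) (K := (phi A).sum + 1) fun n hn =>
        Nat.lt_succ_of_le (Multiset.le_sum_of_mem (hB ▸ hn))
    rw [degSum, hB, ← degSum] at h3
    have hC : schurProd C ∈ cone {C : Multiset (Shape 2) | degSum f A < degSum f C} :=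
      Submodule.subset_span ⟨C, h3, rfl⟩
    have hlead := (hasUnitLead_schurProd hf C).posLeadAt
    by_cases hB' : B' = A
    · subst hB'
      refine ⟨_, hC, ?_, h1⟩
      rintro h0
      exact hlead.ne_zero (by rw [h0, map_zero])
    · obtain ⟨x, hx, -, hxe⟩ := ih _ h4 B' (h2.trans hB) hB' rfl
      refine ⟨x + schurProd C, add_mem hx hC, ?_, by rw [h1, hxe, add_assoc]⟩
      obtain rfl | ⟨D, -, hD⟩ := eq_zero_or_posLeadAt_of_mem_cone hf hx
      · rintro h0
        exact hlead.ne_zero (by rw [← zero_add (schurProd C), h0, map_zero])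
      · rintro h0
        exact (hD.add hlead).ne_zero (by rw [← map_add, h0, map_zero])

/-! ### Exponents that separate partitions -/

/-- Uniqueness of the base `M` expansion. -/
theorem eq_of_sum_mul_pow_eq {M : ℕ} (n : ℕ) (c d : ℕ → ℕ) (hc : ∀ i, c i < M) (hd : ∀ i, d i < M)
    (hcd : ∑ i ∈ Finset.range n, c i * M ^ i = ∑ i ∈ Finset.range n, d i * M ^ i) :
    ∀ i < n, c i = d i := by
  induction n generalizing c d with
  | zero => simp
  | succ n ih =>
    have key : ∀ e : ℕ → ℕ, ∑ i ∈ Finset.range (n + 1), e i * M ^ i =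
        e 0 + M * ∑ i ∈ Finset.range n, e (i + 1) * M ^ i := by
      intro e
      rw [Finset.sum_range_succ', Finset.mul_sum, add_comm]
      simp only [pow_succ, pow_zero, mul_one]
      congr 1
      exact Finset.sum_congr rfl fun i _ => by ring
    rw [key, key] at hcd
    have h0 : c 0 = d 0 := by
      have := congrArg (· % M) hcd
      simpa [Nat.add_mul_mod_self_left, Nat.mod_eq_of_lt (hc 0), Nat.mod_eq_of_lt (hd 0)] using this
    have hM : 0 < M := (Nat.zero_le _).trans_lt (hc 0)
    have h1 := Nat.eq_of_mul_eq_mul_left hM (by omega :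
      M * ∑ i ∈ Finset.range n, c (i + 1) * M ^ i = M * ∑ i ∈ Finset.range n, d (i + 1) * M ^ i)
    have h2 := ih _ _ (fun i => hc (i + 1)) (fun i => hd (i + 1)) h1
    rintro (_ | i) hi
    · exact h0
    · exact h2 i (by omega)

theorem multiset_eq_of_sum_pow_eq {M : ℕ} {s t : Multiset ℕ} (hs : s.card < M) (ht : t.card < M)
    (hst : (s.map (M ^ ·)).sum = (t.map (M ^ ·)).sum) : s = t := by
  set n := s.sum + t.sum + 1
  have key : ∀ u : Multiset ℕ, u.sum < n →
      (u.map (M ^ ·)).sum = ∑ i ∈ Finset.range n, u.count i * M ^ i := by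
    intro u hu
    rw [Finset.sum_multiset_map_count]
    simp only [smul_eq_mul]
    refine Finset.sum_subset (fun i hi => ?_) fun i _ hi => ?_
    · have := Multiset.le_sum_of_mem (Multiset.mem_toFinset.1 hi)
      exact Finset.mem_range.2 (by omega)
    · rw [Multiset.count_eq_zero.2 (by simpa using hi), zero_mul]
  rw [key s (by omega), key t (by omega)] at hst
  have := eq_of_sum_mul_pow_eq n _ _ (fun i => (s.count_le_card i).trans_lt hs)
    (fun i => (t.count_le_card i).trans_lt ht) hst
  ext i
  by_cases hi : i < n
  · exact this i hi
  · rw [Multiset.count_eq_zero.2, Multiset.count_eq_zero.2]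
    · intro h
      have := Multiset.le_sum_of_mem h
      omega
    · intro h
      have := Multiset.le_sum_of_mem h
      omega

theorem strictlyConvex_pow_sub_one {M : ℕ} (hM : 2 ≤ M) :
    StrictlyConvex fun n => M ^ n - 1 := by
  refine ⟨by simp, fun a b hab => ?_⟩
  have h1 : M ^ (b + 1) ≤ M ^ a := Nat.pow_le_pow_right (by omega) hab
  have h2 : 2 * M ^ a ≤ M ^ (a + 1) := by
    rw [pow_succ, mul_comm]
    exact Nat.mul_le_mul_left _ hM
  have h3 : ∀ n, 1 ≤ M ^ n := fun n => Nat.one_le_pow _ _ (by omega)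
  have := h3 a
  have := h3 b
  have := h3 (b + 1)
  have := h3 (a + 1)
  omega

theorem card_phi_le {A : Multiset (Shape k)} : (phi A).card ≤ weight A := by
  rw [← sum_phi]
  simpa using Multiset.card_nsmul_le_sum (a := 1) fun n hn => pos_of_mem_phi hn

/-- Padding with zeros to `N` parts turns the sum of `M ^ n - 1` into a sum of powers. -/
theorem phi_eq_of_degSum_eq {N M : ℕ} (hM : N < M) {A B : Multiset (Shape k)} (hA : weight A = N)
    (hB : weight B = N)
    (hAB : degSum (fun n => M ^ n - 1) A = degSum (fun n => M ^ n - 1) B) : phi A = phi B := by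
  have key : ∀ C : Multiset (Shape k), weight C = N →
      (phi C + Multiset.replicate (N - (phi C).card) 0).card = N ∧
      ((phi C + Multiset.replicate (N - (phi C).card) 0).map (M ^ ·)).sum =
        degSum (fun n => M ^ n - 1) C + N := by
    intro C hC
    have hcard : (phi C).card ≤ N := hC ▸ card_phi_le
    have hsum : ((phi C).map (M ^ ·)).sum = degSum (fun n => M ^ n - 1) C + (phi C).card := by
      rw [degSum]
      generalize phi C = s
      induction s using Multiset.induction_on with
      | empty => simp
      | cons n s ih =>
        have : 1 ≤ M ^ n := Nat.one_le_pow _ _ (by omega)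
        simp only [Multiset.map_cons, Multiset.sum_cons, Multiset.card_cons, ih]
        omega
    refine ⟨by simp; omega, ?_⟩
    rw [Multiset.map_add, Multiset.sum_add, hsum]
    simp
    omega
  obtain ⟨hA1, hA2⟩ := key A hA
  obtain ⟨hB1, hB2⟩ := key B hB
  have := multiset_eq_of_sum_pow_eq (M := M) (hA1.trans_lt hM) (hB1.trans_lt hM)
    (by rw [hA2, hB2, hAB])
  ext n
  rcases Nat.eq_zero_or_pos n with rfl | hn
  · rw [Multiset.count_eq_zero.2 fun h => (pos_of_mem_phi h).ne rfl,
      Multiset.count_eq_zero.2 fun h => (pos_of_mem_phi h).ne rfl]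
  · simpa [Multiset.count_replicate, hn.ne] using congrArg (Multiset.count n) this

/-! ### Extremality -/

/-- The decomposition `s_B = s_A + x` of the generators extends to the cone. The remainder vanishes
only if the coefficient of `s_A` does, because the cone is salient. -/
theorem exists_eq_smul_add_of_mem_cone {f : ℕ → ℕ} (hf : StrictlyConvex f)
    {A : Multiset (Shape 2)} {T : Set (Multiset (Shape 2))}
    (hT : ∀ B ∈ T, ∃ x ∈ cone {C : Multiset (Shape 2) | degSum f A < degSum f C}, x ≠ 0 ∧
      schurProd B = schurProd A + x) {y : MvPolynomial ℕ+ ℝ} (hy : y ∈ cone T) :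
    ∃ c : ℝ, ∃ x ∈ cone {C : Multiset (Shape 2) | degSum f A < degSum f C},
      (x = 0 → c = 0) ∧ y = c • schurProd A + x := by
  unfold cone at hy
  induction hy using Submodule.span_induction with
  | mem y hy =>
    obtain ⟨B, hB, rfl⟩ := hy
    obtain ⟨x, hx, hx0, hxe⟩ := hT B hB
    exact ⟨1, x, hx, fun h => absurd h hx0, by rw [hxe, one_smul]⟩
  | zero => exact ⟨0, 0, zero_mem _, fun _ => rfl, by simp⟩
  | add y z _ _ hy hz =>
    obtain ⟨c, x, hx, hc, rfl⟩ := hy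
    obtain ⟨d, w, hw, hd, rfl⟩ := hz
    refine ⟨c + d, x + w, add_mem hx hw, fun h0 => ?_, by rw [add_smul]; abel⟩
    obtain rfl | ⟨D, -, hD⟩ := eq_zero_or_posLeadAt_of_mem_cone hf hx
    · rw [hc rfl, hd (by simpa using h0), add_zero]
    obtain rfl | ⟨E, -, hE⟩ := eq_zero_or_posLeadAt_of_mem_cone hf hw
    · rw [hd rfl, hc (by simpa using h0), add_zero]
    · exact absurd (by rw [← map_add, h0, map_zero]) (hD.add hE).ne_zero
  | smul r y _ hy =>
    obtain ⟨c, x, hx, hc, rfl⟩ := hy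
    refine ⟨r * c, r • x, Submodule.smul_mem _ r hx, fun h0 => ?_, ?_⟩
    · rcases smul_eq_zero.1 h0 with h | h
      · simp [h]
      · simp [hc h]
    · rw [smul_add, mul_smul]
      rfl

theorem schurProd_notMem_cone {f : ℕ → ℕ} (hf : StrictlyConvex f) {A : Multiset (Shape 2)}
    {S : Set (Multiset (Shape 2))}
    (hS : ∀ B ∈ S, degSum f B = degSum f A →
      ∃ x ∈ cone {C : Multiset (Shape 2) | degSum f A < degSum f C}, x ≠ 0 ∧
        schurProd B = schurProd A + x) : schurProd A ∉ cone S := by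
  intro hmem
  have hsub : S ⊆ {B | degSum f B < degSum f A} ∪
      ({B ∈ S | degSum f B = degSum f A} ∪ {B | degSum f A < degSum f B}) := by
    intro B hB
    rcases lt_trichotomy (degSum f B) (degSum f A) with h | h | h
    · exact Or.inl h
    · exact Or.inr (Or.inl ⟨hB, h⟩)
    · exact Or.inr (Or.inr h)
  have hmem' := Submodule.span_mono (Set.image_mono hsub) hmem
  rw [Set.image_union, Set.image_union, Submodule.span_union, Submodule.span_union] at hmem'
  obtain ⟨x, hx, w, hw, hxw⟩ := Submodule.mem_sup.1 hmem'
  obtain ⟨y, hy, z, hz, rfl⟩ := Submodule.mem_sup.1 hw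
  have hlead := hasUnitLead_schurProd hf A
  obtain ⟨c, v, hv, hvc, rfl⟩ :=
    exists_eq_smul_add_of_mem_cone hf (fun B hB => hS B hB.1 hB.2) hy
  have hvz : v + z ∈ cone {C : Multiset (Shape 2) | degSum f A < degSum f C} := add_mem hv hz
  -- The generators of degree less than that of `A` do not contribute.
  have hx0 : x = 0 := by
    refine (eq_zero_or_posLeadAt_of_mem_cone hf hx).resolve_right ?_
    rintro ⟨B, hB, hBx⟩
    have h1 := congrArg (fun p => (specialize f p).coeff (degSum f B)) hxw
    have h2 := coeff_eq_zero_of_mem_cone hf hvz (i := degSum f B) fun C hC => lt_trans hB hC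
    simp only [map_add, map_smul, coeff_add, coeff_smul, hlead.coeff_of_lt hB] at h1 h2
    have := hBx.2
    simp only [smul_zero] at h1
    linarith
  subst hx0
  -- Compare the coefficients in the degree of `A`.
  have hc : c = 1 := by
    have h1 := congrArg (fun p => (specialize f p).coeff (degSum f A)) hxw
    have h2 := coeff_eq_zero_of_mem_cone hf hvz (i := degSum f A) fun C hC => hC
    simp only [map_add, map_smul, coeff_add, coeff_smul, hlead.coeff_self, map_zero,
      coeff_zero, smul_eq_mul] at h1 h2
    linarith
  subst hc
  have hsum : v + z = 0 := by
    rw [one_smul, zero_add, add_assoc] at hxw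
    exact left_eq_add.1 hxw.symm
  obtain rfl | ⟨D, -, hD⟩ := eq_zero_or_posLeadAt_of_mem_cone hf hv
  · exact one_ne_zero (hvc rfl)
  obtain rfl | ⟨E, -, hE⟩ := eq_zero_or_posLeadAt_of_mem_cone hf hz
  · exact one_ne_zero (hvc (by simpa using hsum))
  · exact (hD.add hE).ne_zero (by rw [← map_add, hsum, map_zero])

end SchurCone

theorem mainTheorem3 (N : ℕ) (lam : N.Partition) (A : Multiset (SchurCone.Shape 2))
    (hA : SchurCone.SSP lam = {A}) : SchurCone.IsExtreme 2 N A := by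
  have hAmem : A ∈ SchurCone.SSP lam := hA ▸ Set.mem_singleton A
  obtain ⟨hAN, -, hAphi⟩ := hAmem
  -- Every base greater than `N` and at least `2` serves.
  have hf := SchurCone.strictlyConvex_pow_sub_one (M := N + 2) (by omega)
  refine ⟨hAN, SchurCone.schurProd_notMem_cone hf fun B hB hdeg => ?_⟩
  refine SchurCone.exists_schurProd_eq_add hf (fun C hC hphi => ?_) B
    (SchurCone.phi_eq_of_degSum_eq (by omega) hB.1 hAN hdeg) hB.2
  have hCN : SchurCone.weight C = N := by rw [← SchurCone.sum_phi, hphi, SchurCone.sum_phi, hAN]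
  have : C ∈ SchurCone.SSP lam := ⟨hCN, hC, hphi.trans hAphi⟩
  rwa [hA] at this
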